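/- All graphs are finite and simple. The girth of a graph that is not a forest is the length of its shortest cycle, and a girth cycle is a cycle (regarded as a subgraph) whose length is the girth. For an edge $e$ let $\epsilon(e)$ be the number of girth cycles that contain $e$. The signature of a vertex $v$ is the tuple $(\epsilon(e_1),\dots,\epsilon(e_k))$, where $e_1,\dots,e_k$ are the edges incident to $v$, ordered so that $\epsilon(e_1)\le\dots\le\epsilon(e_k)$. A graph is girth-regular if all its vertices have the same signature, which is then called the signature of the graph; it is cubic if every vertex has exactly three neighbours. **Corollary.** Up to isomorphism, there are only finitely many connected cubic girth-regular graphs with signature $(2,2,2)$ and girth at most $5$. In fact, every such graph has at most $20$ vertices. -/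

import Mathlib

universe u

namespace SimpleGraph

variable {V : Type u}

/-- The girth cycles of `G`: the cycles of `G`, regarded as subgraphs (so without a base point or a
direction), whose length is the girth of `G`. -/
def girthCycles (G : SimpleGraph V) : Set G.Subgraph :=
  {C | ∃ (v : V) (p : G.Walk v v), p.IsCycle ∧ p.length = G.girth ∧ C = p.toSubgraph}

/-- The number `ε(e)` of girth cycles of `G` that contain the edge `e`. -/
noncomputable def edgeGirthCount (G : SimpleGraph V) (e : Sym2 V) : ℕ :=
  {C | C ∈ G.girthCycles ∧ e ∈ C.edgeSet}.ncard

/-- The signature of the vertex `v` in the finite graph `G`: the numbers `ε(e)`, for all edges `e`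
incident to `v` (with multiplicity), in weakly increasing order. -/
noncomputable def vertexSignature [Finite V] (G : SimpleGraph V) (v : V) : List ℕ :=
  ((Set.toFinite (G.incidenceSet v)).toFinset.val.map G.edgeGirthCount).sort (· ≤ ·)

/-- A graph is girth-regular if all of its vertices have the same signature. -/
def IsGirthRegular [Finite V] (G : SimpleGraph V) : Prop :=
  ∀ v w : V, G.vertexSignature v = G.vertexSignature w

/-- `σ` is the signature of the graph `G`: it is the signature of each vertex of `G`. -/
def HasSignature [Finite V] (G : SimpleGraph V) (σ : List ℕ) : Prop :=
  ∀ v : V, G.vertexSignature v = σ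

end SimpleGraph

/-! Treat the `F` girth cycles as faces. Over `ZMod 2` the vertex-edge and edge-face incidence
matrices have product 0, so their ranks sum to at most `E`. Connectedness gives each corank at most
one, whence `V + F ≤ E + 2` with no surface constructed (`card_add_ncard_girthCycles_le`). With `g *
F = 2 * E` and `2 * E = 3 * V` this becomes `V * (6 - g) ≤ 4 * g`, so `V ≤ 20` when `g ≤ 5`. -/

/-- A matrix all of whose null vectors are constant has corank at most one. -/
theorem Matrix.card_le_rank_add_one {m n K : Type*} [Fintype m] [Fintype n] [Field K]
    (N : Matrix m n K) (h : ∀ x, N.mulVec x = 0 → ∃ c, x = fun _ => c) :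
    Fintype.card n ≤ N.rank + 1 := by
  have hrn := N.mulVecLin.finrank_range_add_finrank_ker
  rw [Module.finrank_fintype_fun_eq_card] at hrn
  have hker : Module.finrank K (LinearMap.ker N.mulVecLin) ≤ 1 := by
    have hle : LinearMap.ker N.mulVecLin ≤ Submodule.span K {fun _ => (1 : K)} := by
      intro x hx
      obtain ⟨c, rfl⟩ := h x (by simpa using hx)
      exact Submodule.mem_span_singleton.2 ⟨c, by ext; simp⟩
    exact (Submodule.finrank_mono hle).trans
      ((finrank_span_le_card _).trans (by simp))
  rw [Matrix.rank]
  omega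

namespace SimpleGraph

theorem Connected.const_of_adj {V : Type*} {α : Type*} {G : SimpleGraph V} (hG : G.Connected)
    (f : V → α) (h : ∀ v w, G.Adj v w → f v = f w) (v w : V) : f v = f w := by
  obtain ⟨p⟩ := hG.preconnected v w
  induction p with
  | nil => rfl
  | cons hadj _ ih => exact (h _ _ hadj).trans ih

section

variable {V : Type*} [Finite V] {G : SimpleGraph V}

theorem edgeGirthCount_eq_of_hasSignature {k : ℕ} (h : G.HasSignature [k, k, k]) {e : Sym2 V}
    (he : e ∈ G.edgeSet) : G.edgeGirthCount e = k := by
  induction e with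
  | _ v w =>
    have hmem : G.edgeGirthCount s(v, w) ∈ G.vertexSignature v := by
      simp only [vertexSignature, Multiset.mem_sort, Multiset.mem_map]
      refine ⟨s(v, w), ?_, rfl⟩
      simpa [mem_incidenceSet] using he
    rw [h v] at hmem
    simpa using hmem

end

variable {V : Type*} {G : SimpleGraph V}

theorem ncard_edgeSet_of_mem_girthCycles {C : G.Subgraph} (hC : C ∈ G.girthCycles) :
    C.edgeSet.ncard = G.girth := by
  classical
  obtain ⟨v, p, hp, hl, rfl⟩ := hC
  have : p.toSubgraph.edgeSet = (p.edges.toFinset : Set (Sym2 V)) := by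
    ext e; simp
  rw [this, Set.ncard_coe_finset, List.toFinset_card_of_nodup hp.edges_nodup, p.length_edges, hl]

theorem ncard_neighborSet_of_mem_girthCycles {C : G.Subgraph} (hC : C ∈ G.girthCycles) {v : V}
    (hv : v ∈ C.verts) : (C.neighborSet v).ncard = 2 := by
  obtain ⟨u, p, hp, -, rfl⟩ := hC
  exact hp.ncard_neighborSet_toSubgraph_eq_two (by simpa using hv)

theorem verts_nonempty_of_mem_girthCycles {C : G.Subgraph} (hC : C ∈ G.girthCycles) :
    C.verts.Nonempty := by
  obtain ⟨u, p, hp, -, rfl⟩ := hC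
  exact ⟨u, by simp⟩

/-- Two girth cycles through a vertex of degree three share an edge at that vertex. -/
theorem exists_common_adj {C D : G.Subgraph} (hC : C ∈ G.girthCycles) (hD : D ∈ G.girthCycles)
    {v : V} (hdeg : (G.neighborSet v).ncard = 3) (hvC : v ∈ C.verts) (hvD : v ∈ D.verts) :
    ∃ w, C.Adj v w ∧ D.Adj v w := by
  have hfin : (G.neighborSet v).Finite := Set.finite_of_ncard_ne_zero (by omega)
  have h1 := ncard_neighborSet_of_mem_girthCycles hC hvC
  have h2 := ncard_neighborSet_of_mem_girthCycles hD hvD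
  have hCs := C.neighborSet_subset v
  have hDs := D.neighborSet_subset v
  -- Two 2-subsets of a 3-set must meet.
  have h3 := Set.ncard_union_add_ncard_inter (C.neighborSet v) (D.neighborSet v)
    (hfin.subset hCs) (hfin.subset hDs)
  have h4 := Set.ncard_le_ncard (Set.union_subset hCs hDs) hfin
  obtain ⟨w, hw⟩ := Set.nonempty_of_ncard_ne_zero
    (s := C.neighborSet v ∩ D.neighborSet v) (by omega)
  exact ⟨w, hw.1, hw.2⟩

/-- The number of edges of a girth cycle at any vertex is even. -/
theorem even_ncard_incident_of_mem_girthCycles {C : G.Subgraph} (hC : C ∈ G.girthCycles) (v : V) :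
    Even {e : G.edgeSet | v ∈ (e : Sym2 V) ∧ (e : Sym2 V) ∈ C.edgeSet}.ncard := by
  have key : {e : G.edgeSet | v ∈ (e : Sym2 V) ∧ (e : Sym2 V) ∈ C.edgeSet}.ncard
      = (C.neighborSet v).ncard := by
    symm
    refine Set.ncard_congr (fun w hw => ⟨s(v, w), C.adj_sub hw⟩) ?_ ?_ ?_
    · intro w hw
      exact ⟨by simp, hw⟩
    · intro a b _ _ h
      exact Sym2.congr_right.1 (congrArg Subtype.val h)
    · rintro ⟨e, he⟩ ⟨hv, heC⟩
      obtain ⟨w, rfl⟩ := Sym2.mem_iff_exists.1 hv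
      exact ⟨w, heC, rfl⟩
  rw [key]
  by_cases hv : v ∈ C.verts
  · rw [ncard_neighborSet_of_mem_girthCycles hC hv]
    exact even_two
  · have : C.neighborSet v = ∅ := by
      ext w
      simpa using fun h : C.Adj v w => hv h.fst_mem
    simp [this]

section

variable [Fintype V] [DecidableRel G.Adj]

open scoped Classical in
/-- The girth cycles of a connected cubic graph with exactly two girth cycles through every edge
are the faces of a map on a closed surface; this is Euler's inequality for that surface. -/
theorem card_add_ncard_girthCycles_le (hG : G.Connected) (hreg : G.IsRegularOfDegree 3)
    (h2 : ∀ e ∈ G.edgeSet, G.edgeGirthCount e = 2) :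
    Fintype.card V + G.girthCycles.ncard ≤ Fintype.card G.edgeSet + 2 := by
  have hdeg (v : V) : (G.neighborSet v).ncard = 3 := by
    rw [Set.ncard_eq_toFinset_card']
    exact hreg v
  let M : Matrix V G.edgeSet (ZMod 2) := .of fun v e => if v ∈ (e : Sym2 V) then 1 else 0
  let A : Matrix G.edgeSet G.girthCycles (ZMod 2) :=
    .of fun e C => if (e : Sym2 V) ∈ C.1.edgeSet then 1 else 0
  have hMA : M * A = 0 := by
    ext v C
    simp only [Matrix.mul_apply, M, A, Matrix.of_apply, Matrix.zero_apply, ← ite_and, mul_ite, mul_one, mul_zero]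
    have := even_ncard_incident_of_mem_girthCycles C.2 v
    rw [Set.ncard_eq_toFinset_card', Set.toFinset_ofPred] at this
    rw [Finset.sum_boole, ZMod.natCast_eq_zero_iff_even]
    simpa only [and_comm] using this
  -- A null vector `y` of the transpose has `y a + y b = 0`, hence `y a = y b`, on every edge.
  have hM : Fintype.card V ≤ M.transpose.rank + 1 := by
    refine Matrix.card_le_rank_add_one _ fun y hy => ?_
    obtain ⟨v₀⟩ := hG.nonempty
    refine ⟨y v₀, funext fun v => hG.const_of_adj y (fun a b hab => ?_) v v₀⟩
    have := congrFun hy ⟨s(a, b), hab⟩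
    simp only [Matrix.mulVec, dotProduct, Matrix.transpose_apply, Matrix.of_apply, M, Pi.zero_apply,
      ite_mul, one_mul, zero_mul, ← Finset.sum_filter] at this
    have hs : Finset.univ.filter (fun x => x ∈ s(a, b)) = {a, b} := by ext; simp
    rw [hs, Finset.sum_pair hab.ne] at this
    exact CharTwo.add_eq_zero.1 this
  -- A null vector agrees on the two girth cycles through an edge, hence on all girth cycles through
  -- a vertex, since any two of them share an edge there.
  have hA : Fintype.card G.girthCycles ≤ A.rank + 1 := by
    refine Matrix.card_le_rank_add_one _ fun x hx => ?_
    have hedge (e : Sym2 V) (he : e ∈ G.edgeSet) : ∃ C D : G.girthCycles, C ≠ D ∧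
        ∀ B : G.girthCycles, e ∈ B.1.edgeSet ↔ B = C ∨ B = D := by
      obtain ⟨C, D, hne, hCD⟩ := Set.ncard_eq_two.1 (h2 e he)
      have hiff (B : G.Subgraph) : B ∈ G.girthCycles ∧ e ∈ B.edgeSet ↔ B = C ∨ B = D := by
        simpa using Set.ext_iff.1 hCD B
      refine ⟨⟨C, ((hiff C).2 (.inl rfl)).1⟩, ⟨D, ((hiff D).2 (.inr rfl)).1⟩, by simpa using hne,
        fun B => ?_⟩
      simpa [B.2, Subtype.ext_iff] using hiff B
    have hshare (e : Sym2 V) (he : e ∈ G.edgeSet) (C D : G.girthCycles) (hC : e ∈ C.1.edgeSet)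
        (hD : e ∈ D.1.edgeSet) : x C = x D := by
      obtain ⟨P, Q, hne, hPQ⟩ := hedge e he
      have := congrFun hx ⟨e, he⟩
      simp only [Matrix.mulVec, dotProduct, Matrix.of_apply, A, Pi.zero_apply, ite_mul, one_mul,
        zero_mul, ← Finset.sum_filter] at this
      have hs : Finset.univ.filter (fun B : G.girthCycles => e ∈ B.1.edgeSet) = {P, Q} := by
        ext B; simp [hPQ]
      rw [hs, Finset.sum_pair hne, CharTwo.add_eq_zero] at this
      rcases (hPQ C).1 hC with rfl | rfl <;> rcases (hPQ D).1 hD with rfl | rfl <;> simp [this]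
    have hvert (v : V) (C D : G.girthCycles) (hC : v ∈ C.1.verts) (hD : v ∈ D.1.verts) :
        x C = x D := by
      obtain ⟨w, hw, hw'⟩ := exists_common_adj C.2 D.2 (hdeg v) hC hD
      exact hshare s(v, w) (C.1.adj_sub hw) C D hw hw'
    have hex (v : V) : ∃ C : G.girthCycles, v ∈ C.1.verts := by
      obtain ⟨w, hw⟩ := Set.nonempty_of_ncard_ne_zero (s := G.neighborSet v) (by simp [hdeg v])
      obtain ⟨C, D, -, hCD⟩ := hedge s(v, w) hw
      have hadj : C.1.Adj v w := (hCD C).2 (.inl rfl)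
      exact ⟨C, hadj.fst_mem⟩
    -- For an edge `ab`, a girth cycle containing it meets `F a` at `a` and `F b` at `b`, so the
    -- common value spreads along edges.
    choose F hF using hex
    have hconst : ∀ v w, x (F v) = x (F w) := by
      refine hG.const_of_adj (fun v => x (F v)) fun a b hab => ?_
      obtain ⟨C, D, -, hCD⟩ := hedge s(a, b) hab
      have hadj : C.1.Adj a b := (hCD C).2 (.inl rfl)
      exact (hvert a _ C (hF a) hadj.fst_mem).trans (hvert b C _ hadj.snd_mem (hF b))
    obtain ⟨v₀⟩ := hG.nonempty
    refine ⟨x (F v₀), funext fun C => ?_⟩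
    obtain ⟨v, hv⟩ := verts_nonempty_of_mem_girthCycles C.2
    exact (hvert v C _ hv (hF v)).trans (hconst v v₀)
  have hrank := Matrix.rank_add_rank_le_card_of_mul_eq_zero hMA
  rw [Matrix.rank_transpose] at hM
  rw [Set.ncard_eq_toFinset_card', Set.toFinset_card]
  omega

-- Double counting of incident pairs (girth cycle, edge).
open scoped Classical in
theorem girth_mul_ncard_girthCycles {k : ℕ} (h : ∀ e ∈ G.edgeSet, G.edgeGirthCount e = k) :
    G.girth * G.girthCycles.ncard = k * Fintype.card G.edgeSet := by
  have hcount := Finset.sum_card_bipartiteAbove_eq_sum_card_bipartiteBelow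
    (s := G.girthCycles.toFinset) (t := G.edgeFinset) (fun C e => e ∈ C.edgeSet)
  rw [Finset.sum_congr (s₂ := G.girthCycles.toFinset) rfl (g := fun _ => G.girth),
    Finset.sum_congr (s₂ := G.edgeFinset) rfl (g := fun _ => k)] at hcount
  · rw [Set.ncard_eq_toFinset_card', ← edgeFinset_card]
    simpa [mul_comm] using hcount
  · intro e he
    rw [← h e (by simpa using he), edgeGirthCount, Set.ncard_eq_toFinset_card']
    congr 1
    ext C
    simp [Finset.bipartiteBelow]
  · intro C hC
    rw [← ncard_edgeSet_of_mem_girthCycles (by simpa using hC : C ∈ G.girthCycles),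
      Set.ncard_eq_toFinset_card']
    congr 1
    ext e
    simpa [Finset.bipartiteAbove] using fun he => C.edgeSet_subset he

theorem card_le_twenty (hG : G.Connected) (hreg : G.IsRegularOfDegree 3)
    (hsig : G.HasSignature [2, 2, 2]) (hgirth : G.girth ≤ 5) : Fintype.card V ≤ 20 := by
  have h2 (e) (he : e ∈ G.edgeSet) : G.edgeGirthCount e = 2 :=
    edgeGirthCount_eq_of_hasSignature hsig he
  have hEuler := card_add_ncard_girthCycles_le hG hreg h2
  have hfaces := girth_mul_ncard_girthCycles h2
  have hedges := G.sum_degrees_eq_twice_card_edges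
  simp only [hreg.degree_eq, Finset.sum_const, Finset.card_univ, smul_eq_mul, edgeFinset_card]
    at hedges
  simp only [← Nat.card_eq_fintype_card] at *
  generalize G.girth = g at *
  -- The values `g < 3`, including the default 0 for forests, need no separate exclusion: the same
  -- linear relations bound `V`.
  interval_cases g <;> omega

end

end SimpleGraph

theorem mainTheorem10 :
    (∃ S : Set (Σ n : ℕ, SimpleGraph (Fin n)), S.Finite ∧
      ∀ (V : Type u) [Fintype V] (G : SimpleGraph V) [DecidableRel G.Adj],
        G.Connected → G.IsRegularOfDegree 3 → G.IsGirthRegular → G.HasSignature [2, 2, 2] →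
        G.girth ≤ 5 → ∃ H ∈ S, Nonempty (G ≃g H.2)) ∧
    (∀ (V : Type u) [Fintype V] (G : SimpleGraph V) [DecidableRel G.Adj],
      G.Connected → G.IsRegularOfDegree 3 → G.IsGirthRegular → G.HasSignature [2, 2, 2] →
      G.girth ≤ 5 → Fintype.card V ≤ 20) := by
  -- `S` consists of all graphs on `Fin n` with `n ≤ 20`.
  refine ⟨⟨⋃ n ∈ Set.Iic 20, Set.range (Sigma.mk n), ?_, ?_⟩, ?_⟩
  · exact (Set.finite_Iic 20).biUnion fun n _ => Set.finite_range _
  · intro V _ G _ hG hreg _ hsig hgirth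
    refine ⟨⟨_, G.overFin rfl⟩, ?_, ⟨G.overFinIso rfl⟩⟩
    simpa using SimpleGraph.card_le_twenty hG hreg hsig hgirth
  · intro V _ G _ hG hreg _ hsig hgirth
    exact SimpleGraph.card_le_twenty hG hreg hsig hgirth
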